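/- Throughout, operators are bounded linear operators on complex Hilbert spaces, $\le$ is the Loewner order, and $A\ge 0$ means that $A$ is positive. An operator $A$ on $\mathcal H$ is called strictly positive if $\langle Ax,x\rangle>0$ for every nonzero $x\in\mathcal H$ (invertibility is not required). A connection $\sigma$ in the sense of Kubo and Ando is a binary operation $(A,B)\mapsto A\sigma B\ge 0$ on the positive operators on Hilbert spaces such that, for positive operators: (i) $A\le C$ and $B\le D$ imply $A\sigma B\le C\sigma D$; (ii) $T^*(A\sigma B)T\le (T^*AT)\sigma(T^*BT)$ for all Hilbert spaces $\mathcal H,\mathcal K$, all $A,B$ on $\mathcal H$ and all bounded linear $T:\mathcal K\to\mathcal H$; (iii) if $A_m\downarrow A$ and $B_m\downarrow B$ (decreasing sequences, strong operator convergence), then $A_m\sigma B_m\downarrow A\sigma B$. An operator mean is a connection with $\mathbf 1\sigma\mathbf 1=\mathbf 1$. Let $\sigma$ be a connection (for instance, any operator mean). Let $\mathcal H,\mathcal K$ be complex Hilbert spaces, let $\Phi_1,\dots,\Phi_n:\mathcal B(\mathcal H)\to\mathcal B(\mathcal K)$ be linear maps that are positive ($X\ge0$ implies $\Phi_i(X)\ge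 0$) and normalized ($\Phi_i(\mathbf 1_{\mathcal H})=\mathbf 1_{\mathcal K}$), and let $A_1,\dots,A_n,B_1,\dots,B_n$ be strictly positive operators on $\mathcal H$. Let $w_1,\dots,w_n>0$ with $\sum_{i=1}^n w_i=1$, let $J\subsetneq\{1,\dots,n\}$ and $J^c=\{1,\dots,n\}\setminus J$ (a sum over the empty set is $0$). Then \[ \begin{aligned} \sum_{i=1}^n w_i\Phi_i(A_i\sigma B_i) &\le\Big(\sum_{i\in J}w_i\Phi_i(A_i)\Big)\sigma\Big(\sum_{i\in J}w_i\Phi_i(B_i)\Big)+\Big(\sum_{i\in J^c}w_i\Phi_i(A_i)\Big)\sigma\Big(\sum_{i\in J^c}w_i\Phi_i(B_i)\Big)\\ &\le\Big(\sum_{i=1}^n w_i\Phi_i(A_i)\Big)\sigma\Big(\sum_{i=1}^n w_i\Phi_i(B_i)\Big). \end{aligned} \] -/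

import Mathlib

open scoped ComplexOrder

universe u

/-- A bounded operator `A` is strictly positive if `⟨A x, x⟩ > 0` for every nonzero `x`
(the order on `ℂ` makes this say that `⟨A x, x⟩` is real and positive).
Invertibility of `A` is not required. -/
def IsStrictlyPositiveOp {H : Type u} [NormedAddCommGroup H] [InnerProductSpace ℂ H]
    (A : H →L[ℂ] H) : Prop :=
  ∀ x : H, x ≠ 0 → 0 < inner ℂ (A x) x

/-- `A n ↓ L`: the sequence `A` is decreasing in the Loewner order and converges to `L`
in the strong operator topology. -/
def DecreasesStronglyTo {H : Type u} [NormedAddCommGroup H] [InnerProductSpace ℂ H]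
    [CompleteSpace H] (A : ℕ → (H →L[ℂ] H)) (L : H →L[ℂ] H) : Prop :=
  Antitone A ∧ ∀ x : H, Filter.Tendsto (fun n => A n x) Filter.atTop (nhds (L x))

/-- A connection in the sense of Kubo and Ando: a binary operation on the positive bounded
operators on complex Hilbert spaces which is jointly monotone, satisfies the transformer
inequality and is continuous from above.  An operator mean is a connection with
`op 1 1 = 1`; that normalization is not part of this structure.

The operation acts on the operators of every Hilbert space, and the transformer inequality, for
bounded operators `T` between possibly different spaces, is what makes it one and the same
operation on all of them.  Values of `op` at operators that are not positive are
irrelevant. -/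
structure OperatorConnection where
  /-- The binary operation `A σ B`. -/
  op : ∀ {H : Type u} [NormedAddCommGroup H] [InnerProductSpace ℂ H] [CompleteSpace H],
    (H →L[ℂ] H) → (H →L[ℂ] H) → (H →L[ℂ] H)
  /-- `A σ B` is positive. -/
  op_nonneg : ∀ {H : Type u} [NormedAddCommGroup H] [InnerProductSpace ℂ H] [CompleteSpace H]
    (A B : H →L[ℂ] H), 0 ≤ A → 0 ≤ B → 0 ≤ op A B
  /-- Joint monotonicity: `A ≤ C` and `B ≤ D` imply `A σ B ≤ C σ D`. -/
  op_mono : ∀ {H : Type u} [NormedAddCommGroup H] [InnerProductSpace ℂ H] [CompleteSpace H]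
    (A B C D : H →L[ℂ] H), 0 ≤ A → 0 ≤ B → A ≤ C → B ≤ D → op A B ≤ op C D
  /-- Transformer inequality: `T* (A σ B) T ≤ (T* A T) σ (T* B T)`. -/
  transformer : ∀ {H K : Type u} [NormedAddCommGroup H] [InnerProductSpace ℂ H] [CompleteSpace H]
    [NormedAddCommGroup K] [InnerProductSpace ℂ K] [CompleteSpace K]
    (T : K →L[ℂ] H) (A B : H →L[ℂ] H), 0 ≤ A → 0 ≤ B →
    T.adjoint ∘L op A B ∘L T ≤ op (T.adjoint ∘L A ∘L T) (T.adjoint ∘L B ∘L T)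
  /-- Continuity from above: `A n ↓ L` and `B n ↓ M` imply `A n σ B n ↓ L σ M`. -/
  continuous_above : ∀ {H : Type u} [NormedAddCommGroup H] [InnerProductSpace ℂ H]
    [CompleteSpace H] (A B : ℕ → (H →L[ℂ] H)) (L M : H →L[ℂ] H),
    (∀ n, 0 ≤ A n) → (∀ n, 0 ≤ B n) → DecreasesStronglyTo A L → DecreasesStronglyTo B M →
    DecreasesStronglyTo (fun n => op (A n) (B n)) (op L M)

/-!
Both inequalities follow from two properties of a connection: superadditivity
`A σ B + C σ D ≤ (A + C) σ (B + D)` (`OperatorConnection.op_add_op_le`), and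
`Φ (A σ B) ≤ Φ A σ Φ B` for every positive linear map `Φ`, unital or not
(`OperatorConnection.map_op_le`).  The second one is applied to the maps `w i • Φ i`.

Superadditivity comes from the transformer inequality for `x ↦ (x, x)` and `x ↦ (x, -x)` from `H` to
`H ⊕ H`, applied to the mean of the block diagonal operators `A ⊕ C` and `B ⊕ D`.

For a positive map no complete positivity is available, and the Kubo-Ando integral representation
is avoided too.  Instead, `1 σ t1` is a scalar `f(t)`, the same on all spaces, because rank one
operators compare numerical ranges across spaces (`OperatorConnection.re_inner_one_op_smul_le`);
hence `P σ tP = f(t) P` for all `P ≥ 0`.  If the pair `(A, B)` were a finite sum of proportional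
pairs `(P i, μ i • P i)` on which `σ` is additive, superadditivity on the target space would give
`Φ (A σ B) = ∑ f(μ i) Φ (P i) = ∑ Φ (P i) σ (μ i • Φ (P i)) ≤ Φ A σ Φ B`.  When `A` and `B` are
bounded below this holds up to a factor `q` arbitrarily close to `1`
(`OperatorConnection.exists_proportional_decomposition`): a congruence makes `A = 1`, and a
continuous quadratic partition of unity `∑ (T i)² = 1` in the functional calculus of `C`, fine
in the multiplicative sense, replaces spectral projections.  Since `1 σ C` commutes with
`T i` (`OperatorConnection.commute_one_op`), it is the sum of its localizations `T i (1 σ C) T i`,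
to each of which the transformer inequality applies.  The general case follows by adding multiples
of `1` to `A` and `B` and using continuity from above.
-/

/-! ### Order and quadratic forms of operators -/

theorem IsStrictlyPositiveOp.nonneg {H : Type u} [NormedAddCommGroup H]
    [InnerProductSpace ℂ H] {A : H →L[ℂ] H} (hA : IsStrictlyPositiveOp A) : 0 ≤ A := by
  rw [ContinuousLinearMap.nonneg_iff_isPositive, ContinuousLinearMap.isPositive_iff_complex]
  intro x
  have h : 0 ≤ inner ℂ (A x) x := by
    rcases eq_or_ne x 0 with rfl | hx
    · simp
    · exact (hA x hx).le
  rw [Complex.nonneg_iff] at h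
  exact ⟨by apply Complex.ext <;> simp [h.2.symm], h.1⟩

theorem ContinuousLinearMap.re_inner_le_of_le {H : Type u} [NormedAddCommGroup H]
    [InnerProductSpace ℂ H] {A B : H →L[ℂ] H} (h : A ≤ B) (x : H) :
    (inner ℂ (A x) x).re ≤ (inner ℂ (B x) x).re := by
  rw [le_def] at h
  simpa [inner_sub_left] using h.re_inner_nonneg_left x

section
variable {H K : Type u} [NormedAddCommGroup H] [InnerProductSpace ℂ H] [CompleteSpace H]
  [NormedAddCommGroup K] [InnerProductSpace ℂ K] [CompleteSpace K]

theorem ContinuousLinearMap.le_of_forall_re_inner_le {A B : H →L[ℂ] H} (hA : IsSelfAdjoint A)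
    (hB : IsSelfAdjoint B)
    (h : ∀ x : H, ‖x‖ = 1 → (inner ℂ (A x) x).re ≤ (inner ℂ (B x) x).re) : A ≤ B := by
  rw [le_def, isPositive_def']
  refine ⟨hB.sub hA, fun x => ?_⟩
  rcases eq_or_ne x 0 with rfl | hx
  · simp [reApplyInnerSelf]
  · have hx' : (0 : ℝ) < ‖x‖ := norm_pos_iff.2 hx
    have h1 := h ((‖x‖⁻¹ : ℝ) • x) (by rw [norm_smul]; simp [hx'.ne'])
    rw [← Complex.coe_smul] at h1
    simp only [map_smul, inner_smul_left, inner_smul_right, Complex.conj_ofReal, ← mul_assoc,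
      ← Complex.ofReal_mul, Complex.re_ofReal_mul] at h1
    have h2 := le_of_mul_le_mul_left h1 (by positivity)
    simpa [reApplyInnerSelf, inner_sub_left] using h2

open ContinuousLinearMap in
theorem ContinuousLinearMap.adjoint_comp_comp_mono {A B : H →L[ℂ] H} (hAB : A ≤ B)
    (T : K →L[ℂ] H) : adjoint T ∘L A ∘L T ≤ adjoint T ∘L B ∘L T := by
  rw [le_def] at hAB ⊢
  simpa [comp_sub, sub_comp] using hAB.adjoint_conj T

theorem le_of_forall_pos_le_add_smul {X Y Z : H →L[ℂ] H}
    (h : ∀ ε : ℝ, 0 < ε → X ≤ Y + ε • Z) : X ≤ Y := by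
  have hlim : Filter.Tendsto (fun ε : ℝ => Y + ε • Z) (nhdsWithin 0 (Set.Ioi 0)) (nhds Y) := by
    have : Filter.Tendsto (fun ε : ℝ => Y + ε • Z) (nhds 0) (nhds (Y + (0 : ℝ) • Z)) :=
      Continuous.tendsto (by fun_prop) 0
    rw [zero_smul, add_zero] at this
    exact this.mono_left nhdsWithin_le_nhds
  exact ge_of_tendsto hlim (eventually_nhdsWithin_of_forall fun ε hε => h ε hε)

theorem decreasesStronglyTo_add_one_div_smul (A : H →L[ℂ] H) {P : H →L[ℂ] H} (hP : 0 ≤ P) :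
    DecreasesStronglyTo (fun m : ℕ => A + (1 / ((m : ℝ) + 1)) • P) A := by
  refine ⟨fun m k hmk => ?_, fun x => ?_⟩
  · exact add_le_add_right
      (smul_le_smul_of_nonneg_right (Nat.one_div_le_one_div hmk) hP) A
  · have h := (tendsto_one_div_add_atTop_nhds_zero_nat (𝕜 := ℝ)).smul_const (P x)
    simpa using h.const_add (A x)

theorem map_le_map_of_positive {Φ : (H →L[ℂ] H) →ₗ[ℂ] (K →L[ℂ] K)}
    (hΦ : ∀ X, 0 ≤ X → 0 ≤ Φ X) {X Y : H →L[ℂ] H} (h : X ≤ Y) : Φ X ≤ Φ Y := by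
  rw [← sub_nonneg, ← map_sub]
  exact hΦ _ (sub_nonneg.2 h)

/-- An operator `A ≥ ε`, `ε > 0`, has the form `S²` with `S` selfadjoint and invertible; `R` is the
inverse of `S`. -/
theorem exists_sqrt_with_inverse {A : H →L[ℂ] H} {ε : ℝ} (hε : 0 < ε) (hA : ε • 1 ≤ A) :
    ∃ S R : H →L[ℂ] H, IsSelfAdjoint S ∧ IsSelfAdjoint R ∧ S * S = A ∧ S * R = 1 ∧ R * S = 1 := by
  have hA0 : 0 ≤ A := (smul_nonneg hε.le zero_le_one).trans hA
  have hu : IsUnit A := CStarAlgebra.isUnit_of_le (ε • (1 : H →L[ℂ] H)) hA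
    (IsStrictlyPositive.smul hε isStrictlyPositive_one)
  obtain ⟨s, hs⟩ := (CFC.isUnit_sqrt_iff A hA0).2 hu
  have hsa : IsSelfAdjoint (s : H →L[ℂ] H) := by
    rw [hs]; exact IsSelfAdjoint.of_nonneg (CFC.sqrt_nonneg A)
  refine ⟨s, ↑s⁻¹, hsa, ?_, by rw [hs]; exact CFC.sqrt_mul_sqrt_self A hA0, s.mul_inv, s.inv_mul⟩
  have h1 : star (↑s⁻¹ : H →L[ℂ] H) * s = 1 := by
    have := congrArg star s.mul_inv
    rwa [star_mul, hsa.star_eq, star_one] at this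
  exact left_inv_eq_right_inv h1 s.mul_inv

/-- The congruence by which an operator `A = S²` becomes `1` keeps operators bounded below. -/
theorem exists_smul_one_le_conj {A B S R : H →L[ℂ] H} {ε : ℝ} (hε : 0 < ε) (hA : 0 ≤ A)
    (hB : ε • 1 ≤ B) (hR : IsSelfAdjoint R) (hSS : S * S = A) (hSR : S * R = 1)
    (hRS : R * S = 1) : ∃ c : ℝ, 0 < c ∧ c • 1 ≤ R * B * R := by
  have hAn : A ≤ (‖A‖ + 1) • (1 : H →L[ℂ] H) := by
    refine (IsSelfAdjoint.of_nonneg hA).le_algebraMap_norm_self.trans ?_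
    rw [Algebra.algebraMap_eq_smul_one]
    exact smul_le_smul_of_nonneg_right (by linarith) zero_le_one
  have h1 := hR.conjugate_le_conjugate hAn
  have h2 : R * A * R = 1 := by
    rw [← hSS]
    calc R * (S * S) * R = (R * S) * (S * R) := by noncomm_ring
      _ = 1 := by rw [hRS, hSR, one_mul]
  have h3 := hR.conjugate_le_conjugate hB
  simp only [mul_one, mul_smul_comm, smul_mul_assoc] at h1 h3
  rw [h2] at h1
  have hn : 0 < ‖A‖ + 1 := by positivity
  refine ⟨ε * (‖A‖ + 1)⁻¹, by positivity, le_trans ?_ h3⟩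
  rw [mul_smul]
  refine smul_le_smul_of_nonneg_left ?_ hε.le
  have h4 := smul_le_smul_of_nonneg_left h1 (inv_nonneg.2 hn.le)
  rwa [smul_smul, inv_mul_cancel₀ hn.ne', one_smul] at h4

/-! ### Congruence and commutation -/

theorem OperatorConnection.star_mul_op_mul_le (σ : OperatorConnection.{u}) (T : H →L[ℂ] H)
    {A B : H →L[ℂ] H} (hA : 0 ≤ A) (hB : 0 ≤ B) :
    star T * σ.op A B * T ≤ σ.op (star T * A * T) (star T * B * T) :=
  σ.transformer T A B hA hB

theorem OperatorConnection.conj_op_le (σ : OperatorConnection.{u}) {T : H →L[ℂ] H}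
    (hT : IsSelfAdjoint T) {A B : H →L[ℂ] H} (hA : 0 ≤ A) (hB : 0 ≤ B) :
    T * σ.op A B * T ≤ σ.op (T * A * T) (T * B * T) := by
  simpa [hT.star_eq] using σ.star_mul_op_mul_le T hA hB

/-- For an invertible selfadjoint `S` the reverse of the transformer inequality holds too. -/
theorem OperatorConnection.op_conj_le (σ : OperatorConnection.{u}) {S R : H →L[ℂ] H}
    (hS : IsSelfAdjoint S) (hR : IsSelfAdjoint R) (hSR : S * R = 1) (hRS : R * S = 1)
    {A B : H →L[ℂ] H} (hA : 0 ≤ A) (hB : 0 ≤ B) :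
    σ.op (S * A * S) (S * B * S) ≤ S * σ.op A B * S := by
  have h := hS.conjugate_le_conjugate
    (σ.conj_op_le hR (hS.conjugate_nonneg hA) (hS.conjugate_nonneg hB))
  have e : ∀ X : H →L[ℂ] H, R * (S * X * S) * R = X := fun X => by
    calc R * (S * X * S) * R = (R * S) * X * (S * R) := by noncomm_ring
      _ = X := by rw [hRS, hSR, one_mul, mul_one]
  have e' : ∀ X : H →L[ℂ] H, S * (R * X * R) * S = X := fun X => by
    calc S * (R * X * R) * S = (S * R) * X * (R * S) := by noncomm_ring
      _ = X := by rw [hRS, hSR, one_mul, mul_one]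
  rwa [e', e, e] at h

/-- `1 σ C` commutes with every selfadjoint contraction commuting with `C`, because it commutes
with every unitary commuting with `C`. -/
theorem OperatorConnection.commute_one_op (σ : OperatorConnection.{u}) {S C : H →L[ℂ] H}
    (hC : 0 ≤ C) (hS : IsSelfAdjoint S) (hS1 : ‖S‖ ≤ 1) (hSC : Commute S C) :
    Commute S (σ.op 1 C) := by
  -- `U = S + i √(1 - S²)` is a unitary commuting with `C`
  set R := CFC.sqrt (1 - S ^ 2) with hR
  have hRsa : IsSelfAdjoint R := IsSelfAdjoint.of_nonneg (CFC.sqrt_nonneg _)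
  have hRC : Commute R C :=
    Commute.cfcₙ_nnreal ((Commute.one_left C).sub_left (hSC.pow_left 2)) _
  set U := S + Complex.I • R with hU
  have hUu : U ∈ unitary (H →L[ℂ] H) := hS.self_add_I_smul_cfcSqrt_sub_sq_mem_unitary S hS1
  have hUs : star U = S - Complex.I • R := by
    simp [hU, hS.star_eq, hRsa.star_eq, sub_eq_add_neg]
  have hUC : Commute U C := hSC.add_left (hRC.smul_left _)
  have hU'C : Commute (star U) C := by rw [hUs]; exact hSC.sub_left (hRC.smul_left _)
  have h1 : star U * U = 1 := Unitary.star_mul_self_of_mem hUu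
  have h2 : U * star U = 1 := Unitary.mul_star_self_of_mem hUu
  have e1 : star U * C * U = C := by rw [hU'C.eq, mul_assoc, h1, mul_one]
  have e2 : U * C * star U = C := by rw [hUC.eq, mul_assoc, h2, mul_one]
  have l1 : star U * σ.op 1 C * U ≤ σ.op 1 C := by
    simpa [h1, e1] using σ.star_mul_op_mul_le U zero_le_one hC
  have l2 : U * σ.op 1 C * star U ≤ σ.op 1 C := by
    simpa [h2, e2] using σ.star_mul_op_mul_le (star U) zero_le_one hC
  have l3 : σ.op 1 C ≤ star U * σ.op 1 C * U := by
    refine le_trans (le_of_eq ?_) (star_left_conjugate_le_conjugate l2 U)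
    calc σ.op 1 C = (star U * U) * σ.op 1 C * (star U * U) := by simp [h1]
      _ = _ := by noncomm_ring
  have hXe : star U * σ.op 1 C * U = σ.op 1 C := le_antisymm l1 l3
  have c1 : Commute U (σ.op 1 C) := by
    calc U * σ.op 1 C = U * (star U * σ.op 1 C * U) := by rw [hXe]
      _ = (U * star U) * σ.op 1 C * U := by noncomm_ring
      _ = σ.op 1 C * U := by rw [h2, one_mul]
  have c2 : Commute (star U) (σ.op 1 C) := by
    calc star U * σ.op 1 C = star U * σ.op 1 C * (U * star U) := by rw [h2, mul_one]
      _ = (star U * σ.op 1 C * U) * star U := by noncomm_ring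
      _ = σ.op 1 C * star U := by rw [hXe]
  -- `S` is the real part of `U`
  have hSe : S = (2⁻¹ : ℝ) • (U + star U) := by
    rw [hUs, hU, add_add_sub_cancel, ← two_smul ℝ S, smul_smul]; norm_num
  rw [hSe]
  exact (c1.add_left c2).smul_left _

/-! ### Superadditivity -/

open ContinuousLinearMap in
/-- Superadditivity, given two isometries `V`, `W` with orthogonal ranges.  Put
`X = (V A V* + W C W*) σ (V B V* + W D W*)`.  Compressing `X` by `V + W` and by `V - W` gives
operators below `(A + C) σ (B + D)`; in the sum of the two compressions the off-diagonal parts of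
`X` cancel, and the diagonal ones dominate `A σ B` and `C σ D`. -/
theorem OperatorConnection.op_add_op_le_of_isometries (σ : OperatorConnection.{u})
    (V W : H →L[ℂ] K) (hVV : ∀ x, adjoint V (V x) = x) (hWW : ∀ x, adjoint W (W x) = x)
    (hVW : ∀ x, adjoint V (W x) = 0) (hWV : ∀ x, adjoint W (V x) = 0)
    {A B C D : H →L[ℂ] H} (hA : 0 ≤ A) (hB : 0 ≤ B) (hC : 0 ≤ C) (hD : 0 ≤ D) :
    σ.op A B + σ.op C D ≤ σ.op (A + C) (B + D) := by
  have conj_nonneg : ∀ (U : H →L[ℂ] K) {E : H →L[ℂ] H}, 0 ≤ E → 0 ≤ U ∘L E ∘L adjoint U := by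
    intro U E hE
    simpa using adjoint_comp_comp_mono hE (adjoint U)
  set A' := V ∘L A ∘L adjoint V + W ∘L C ∘L adjoint W with hA'
  set B' := V ∘L B ∘L adjoint V + W ∘L D ∘L adjoint W with hB'
  have hA'0 : 0 ≤ A' := add_nonneg (conj_nonneg V hA) (conj_nonneg W hC)
  have hB'0 : 0 ≤ B' := add_nonneg (conj_nonneg V hB) (conj_nonneg W hD)
  set X := σ.op A' B' with hX
  -- the two diagonal blocks of `X`
  have hV : σ.op A B ≤ adjoint V ∘L X ∘L V := by
    have h := (σ.transformer (adjoint V) A B hA hB).trans (σ.op_mono _ _ A' B'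
      (by simpa using conj_nonneg V hA) (by simpa using conj_nonneg V hB)
      (by simpa [hA'] using conj_nonneg W hC) (by simpa [hB'] using conj_nonneg W hD))
    refine le_trans (le_of_eq ?_) (adjoint_comp_comp_mono h V)
    ext x; simp [hVV]
  have hW : σ.op C D ≤ adjoint W ∘L X ∘L W := by
    have h := (σ.transformer (adjoint W) C D hC hD).trans (σ.op_mono _ _ A' B'
      (by simpa using conj_nonneg W hC) (by simpa using conj_nonneg W hD)
      (by simpa [hA'] using conj_nonneg V hA) (by simpa [hB'] using conj_nonneg V hB))
    refine le_trans (le_of_eq ?_) (adjoint_comp_comp_mono h W)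
    ext x; simp [hWW]
  have hp : adjoint (V + W) ∘L X ∘L (V + W) ≤ σ.op (A + C) (B + D) := by
    convert σ.transformer (V + W) A' B' hA'0 hB'0 using 2 <;>
    · ext x; simp [hA', hB', hVV, hWW, hVW, hWV]
  have hm : adjoint (V - W) ∘L X ∘L (V - W) ≤ σ.op (A + C) (B + D) := by
    convert σ.transformer (V - W) A' B' hA'0 hB'0 using 2 <;>
    · ext x; simp [hA', hB', hVV, hWW, hVW, hWV]
  have key : (2 : ℝ) • (σ.op A B + σ.op C D) ≤ (2 : ℝ) • σ.op (A + C) (B + D) := by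
    calc (2 : ℝ) • (σ.op A B + σ.op C D)
        ≤ (2 : ℝ) • (adjoint V ∘L X ∘L V + adjoint W ∘L X ∘L W) :=
          smul_le_smul_of_nonneg_left (add_le_add hV hW) zero_le_two
      _ = adjoint (V + W) ∘L X ∘L (V + W) + adjoint (V - W) ∘L X ∘L (V - W) := by
          ext x; simp [two_smul]; abel
      _ ≤ (2 : ℝ) • σ.op (A + C) (B + D) := by
          rw [two_smul]; exact add_le_add hp hm
  exact le_of_smul_le_smul_left key two_pos

/-- A connection is superadditive. -/
theorem OperatorConnection.op_add_op_le (σ : OperatorConnection.{u})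
    {A B C D : H →L[ℂ] H} (hA : 0 ≤ A) (hB : 0 ≤ B) (hC : 0 ≤ C) (hD : 0 ≤ D) :
    σ.op A B + σ.op C D ≤ σ.op (A + C) (B + D) := by
  let P : WithLp 2 (H × H) →L[ℂ] H := WithLp.fstL 2 ℂ H H
  let Q : WithLp 2 (H × H) →L[ℂ] H := WithLp.sndL 2 ℂ H H
  have hP : ∀ x, ContinuousLinearMap.adjoint P x = WithLp.toLp 2 (x, 0) := fun x =>
    ext_inner_right ℂ fun y => by
      rw [ContinuousLinearMap.adjoint_inner_left]; simp [P, WithLp.prod_inner_apply]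
  have hQ : ∀ x, ContinuousLinearMap.adjoint Q x = WithLp.toLp 2 (0, x) := fun x =>
    ext_inner_right ℂ fun y => by
      rw [ContinuousLinearMap.adjoint_inner_left]; simp [Q, WithLp.prod_inner_apply]
  refine σ.op_add_op_le_of_isometries (ContinuousLinearMap.adjoint P)
    (ContinuousLinearMap.adjoint Q) ?_ ?_ ?_ ?_ hA hB hC hD <;>
  · intro x; simp only [ContinuousLinearMap.adjoint_adjoint, hP, hQ]; simp [P, Q]

theorem OperatorConnection.sum_op_le (σ : OperatorConnection.{u}) {ι : Type*} (s : Finset ι)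
    (A B : ι → (H →L[ℂ] H)) (hA : ∀ i ∈ s, 0 ≤ A i) (hB : ∀ i ∈ s, 0 ≤ B i) :
    ∑ i ∈ s, σ.op (A i) (B i) ≤ σ.op (∑ i ∈ s, A i) (∑ i ∈ s, B i) := by
  classical
  induction s using Finset.induction_on with
  | empty => simpa using σ.op_nonneg (0 : H →L[ℂ] H) 0 le_rfl le_rfl
  | insert a s ha ih =>
    simp only [Finset.forall_mem_insert] at hA hB
    rw [Finset.sum_insert ha, Finset.sum_insert ha, Finset.sum_insert ha]
    exact (add_le_add_right (ih hA.2 hB.2) _).trans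
      (σ.op_add_op_le hA.1 hB.1 (Finset.sum_nonneg hA.2) (Finset.sum_nonneg hB.2))

/-! ### Proportional pairs -/

open ContinuousLinearMap in
/-- The transformer inequality for the rank one operator sending `k` to `h` compares the numerical
ranges of `1 σ t1` on two spaces.  Exchanging the roles of the spaces shows that `1 σ t1` is a
scalar, the same one on every space. -/
theorem OperatorConnection.re_inner_one_op_smul_le (σ : OperatorConnection.{u}) {t : ℝ}
    (ht : 0 ≤ t) {h : H} {k : K} (hh : ‖h‖ = 1) (hk : ‖k‖ = 1) :
    (inner ℂ (σ.op (1 : H →L[ℂ] H) (t • 1) h) h).re ≤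
      (inner ℂ (σ.op (1 : K →L[ℂ] K) (t • 1) k) k).re := by
  set T : K →L[ℂ] H := InnerProductSpace.rankOne ℂ h k with hT
  have hTk : T k = h := by simp [hT, hk]
  have hTT : adjoint T ∘L (1 : H →L[ℂ] H) ∘L T = InnerProductSpace.rankOne ℂ k k := by
    ext x; simp [hT, hh]
  have hP := InnerProductSpace.isStarProjection_rankOne_self (𝕜 := ℂ) hk
  have hle : adjoint T ∘L (1 : H →L[ℂ] H) ∘L T ≤ 1 := by rw [hTT]; exact hP.le_one
  have hle0 : 0 ≤ adjoint T ∘L (1 : H →L[ℂ] H) ∘L T := by rw [hTT]; exact hP.nonneg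
  have hsm : adjoint T ∘L (t • (1 : H →L[ℂ] H)) ∘L T
      = t • (adjoint T ∘L (1 : H →L[ℂ] H) ∘L T) := by ext x; simp
  have h1 := σ.transformer T 1 (t • 1) zero_le_one (smul_nonneg ht zero_le_one)
  rw [hsm] at h1
  have h2 := re_inner_le_of_le (h1.trans (σ.op_mono _ _ 1 (t • 1) hle0 (smul_nonneg ht hle0) hle
    (smul_le_smul_of_nonneg_left hle ht))) k
  simpa [adjoint_inner_left, hTk] using h2

theorem OperatorConnection.exists_scalar_one_op (σ : OperatorConnection.{u}) (H K : Type u)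
    [NormedAddCommGroup H] [InnerProductSpace ℂ H] [CompleteSpace H] [Nontrivial H]
    [NormedAddCommGroup K] [InnerProductSpace ℂ K] [CompleteSpace K] {t : ℝ} (ht : 0 ≤ t) :
    ∃ c : ℝ, σ.op (1 : H →L[ℂ] H) (t • 1) ≤ c • 1 ∧
      c • 1 ≤ σ.op (1 : K →L[ℂ] K) (t • 1) := by
  -- the scalar is the value of the quadratic form of `1 σ t1` at any unit vector of `H`
  obtain ⟨h, hh⟩ := exists_norm_eq H zero_le_one
  have h0 : ∀ (E : Type u) [NormedAddCommGroup E] [InnerProductSpace ℂ E] [CompleteSpace E],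
      0 ≤ σ.op (1 : E →L[ℂ] E) (t • 1) := fun E _ _ _ =>
    σ.op_nonneg _ _ zero_le_one (smul_nonneg ht zero_le_one)
  have hc : 0 ≤ (inner ℂ (σ.op (1 : H →L[ℂ] H) (t • 1) h) h).re := by
    simpa using ContinuousLinearMap.re_inner_le_of_le (h0 H) h
  have hsa : ∀ (E : Type u) [NormedAddCommGroup E] [InnerProductSpace ℂ E] [CompleteSpace E],
      IsSelfAdjoint ((inner ℂ (σ.op (1 : H →L[ℂ] H) (t • 1) h) h).re • (1 : E →L[ℂ] E)) :=
    fun E _ _ _ => IsSelfAdjoint.of_nonneg (smul_nonneg hc zero_le_one)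
  refine ⟨_,
    ContinuousLinearMap.le_of_forall_re_inner_le (IsSelfAdjoint.of_nonneg (h0 H)) (hsa H) ?_,
    ContinuousLinearMap.le_of_forall_re_inner_le (hsa K) (IsSelfAdjoint.of_nonneg (h0 K)) ?_⟩
  · intro x hx
    have := σ.re_inner_one_op_smul_le ht hx hh
    simpa [hx, inner_smul_left, ← Complex.coe_smul] using this
  · intro x hx
    have := σ.re_inner_one_op_smul_le ht hh hx
    simpa [hx, inner_smul_left, ← Complex.coe_smul] using this

theorem OperatorConnection.smul_le_op_smul (σ : OperatorConnection.{u}) {t c : ℝ} (ht : 0 ≤ t)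
    (hc : c • 1 ≤ σ.op (1 : H →L[ℂ] H) (t • 1)) {Q : H →L[ℂ] H} (hQ : 0 ≤ Q) :
    c • Q ≤ σ.op Q (t • Q) := by
  have hs : IsSelfAdjoint (CFC.sqrt Q) := IsSelfAdjoint.of_nonneg (CFC.sqrt_nonneg Q)
  have h := (hs.conjugate_le_conjugate hc).trans
    (σ.conj_op_le hs zero_le_one (smul_nonneg ht zero_le_one))
  simpa [CFC.sqrt_mul_sqrt_self Q hQ] using h

theorem OperatorConnection.op_smul_le_smul (σ : OperatorConnection.{u}) {t c : ℝ} (ht : 0 ≤ t)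
    (hc : σ.op (1 : H →L[ℂ] H) (t • 1) ≤ c • 1) {Q : H →L[ℂ] H} (hQ : 0 ≤ Q) :
    σ.op Q (t • Q) ≤ c • Q := by
  -- `Q` need not be invertible, but `Q + ε` is
  refine le_of_forall_pos_le_add_smul (Z := c • 1) fun ε hε => ?_
  have hle : Q ≤ Q + ε • 1 := le_add_of_nonneg_right (smul_nonneg hε.le zero_le_one)
  obtain ⟨S, R, hS, hR, hSS, hSR, hRS⟩ :=
    exists_sqrt_with_inverse (A := Q + ε • 1) hε (le_add_of_nonneg_left hQ)
  have h := (σ.op_conj_le hS hR hSR hRS zero_le_one (smul_nonneg ht zero_le_one)).trans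
    (hS.conjugate_le_conjugate hc)
  simp only [mul_one, mul_smul_comm, smul_mul_assoc, hSS] at h
  calc σ.op Q (t • Q) ≤ σ.op (Q + ε • 1) (t • (Q + ε • 1)) :=
        σ.op_mono _ _ _ _ hQ (smul_nonneg ht hQ) hle (smul_le_smul_of_nonneg_left hle ht)
    _ ≤ c • (Q + ε • 1) := h
    _ = c • Q + ε • c • 1 := by rw [smul_add, smul_comm]

/-! ### Partitions of unity -/

/-- A continuous partition of unity on `[c, M]` whose members have small support in the
multiplicative sense: on the support of `g i` the identity lies between `μ i` and `q * μ i`. -/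
theorem exists_partition_of_unity_Icc {c q : ℝ} (hc : 0 < c) (hq : 1 < q) (M : ℝ) :
    ∃ (N : ℕ) (g : ℕ → ℝ → ℝ) (μ : ℕ → ℝ), (∀ i, Continuous (g i)) ∧ (∀ i x, 0 ≤ g i x) ∧
      (∀ i x, g i x ≤ 1) ∧ (∀ i, 0 ≤ μ i) ∧
      (∀ x, c ≤ x → x ≤ M → ∑ i ∈ Finset.range N, g i x = 1) ∧
      ∀ i x, μ i * g i x ≤ x * g i x ∧ x * g i x ≤ q * μ i * g i x := by
  -- `g i` is the hat function centred at `c + i * δ` with support `[μ i, μ i + 2 * δ]`, written as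
  -- a difference of two ramps so that the sum telescopes; `δ` is chosen so that `μ 0 = c - δ`
  -- satisfies `μ 0 + 2 * δ = q * μ 0`
  set δ : ℝ := (q - 1) * c / (q + 1) with hδ
  have hq1 : 0 < q + 1 := by linarith
  have hδ0 : 0 < δ := div_pos (mul_pos (by linarith) hc) hq1
  have hcδ : c + δ = q * (c - δ) := by rw [hδ]; field_simp; ring
  have hcδ0 : 0 < c - δ := by nlinarith
  set r : ℝ → ℝ := fun t => max 0 (min 1 t) with hr
  have hr_mono : Monotone r := fun a b hab => max_le_max le_rfl (min_le_min le_rfl hab)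
  have hr0 : ∀ t, t ≤ 0 → r t = 0 := fun t ht => by
    simp only [hr]; exact max_eq_left ((min_le_right _ _).trans ht)
  have hr1 : ∀ t, 1 ≤ t → r t = 1 := fun t ht => by
    simp only [hr]; rw [min_eq_left ht]; exact max_eq_right zero_le_one
  have hr_nonneg : ∀ t, 0 ≤ r t := fun t => le_max_left _ _
  have hr_le : ∀ t, r t ≤ 1 := fun t => max_le zero_le_one (min_le_left _ _)
  refine ⟨⌈(M - c) / δ + 1⌉₊, fun i x => r ((x - c) / δ + 1 - i) - r ((x - c) / δ - i),
    fun i => c + (i - 1) * δ, fun i => by simp only [hr]; fun_prop, fun i x => ?_, fun i x => ?_,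
    fun i => ?_, fun x hcx hxM => ?_, fun i x => ?_⟩
  · exact sub_nonneg.2 (hr_mono (by linarith))
  · linarith [hr_le ((x - c) / δ + 1 - i), hr_nonneg ((x - c) / δ - i)]
  · have : 0 ≤ (i : ℝ) * δ := by positivity
    linarith
  · have htel : ∀ N : ℕ, ∑ i ∈ Finset.range N, (r ((x - c) / δ + 1 - i) - r ((x - c) / δ - i))
        = r ((x - c) / δ + 1 - (0 : ℕ)) - r ((x - c) / δ + 1 - N) := fun N => by
      rw [← Finset.sum_range_sub' (fun i : ℕ => r ((x - c) / δ + 1 - i))]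
      refine Finset.sum_congr rfl fun i _ => ?_
      congr 2; push_cast; ring
    rw [htel, hr1, hr0, sub_zero]
    · have h1 : (x - c) / δ ≤ (M - c) / δ := by gcongr
      linarith [Nat.le_ceil ((M - c) / δ + 1)]
    · have : 0 ≤ (x - c) / δ := div_nonneg (by linarith) hδ0.le
      push_cast; linarith
  · beta_reduce
    have hx : x = c + (x - c) / δ * δ := by field_simp; ring
    set u := (x - c) / δ
    have hi : 0 ≤ (i : ℝ) * δ := by positivity
    rcases le_or_gt (u + 1 - i) 0 with h | h
    · simp [hr0 _ h, hr0 (u - i) (by linarith)]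
    rcases le_or_gt 1 (u - i) with h' | h'
    · simp [hr1 _ h', hr1 (u + 1 - i) (by linarith)]
    have hg : 0 ≤ r (u + 1 - i) - r (u - i) := sub_nonneg.2 (hr_mono (by linarith))
    constructor
    · refine mul_le_mul_of_nonneg_right ?_ hg
      nlinarith
    · refine mul_le_mul_of_nonneg_right ?_ hg
      calc x ≤ (c + δ) + i * δ := by nlinarith
        _ ≤ q * (c - δ) + q * (i * δ) := by rw [hcδ]; nlinarith
        _ = q * (c + (i - 1) * δ) := by ring

/-- Quadratic partition of unity subordinate to an operator `C ≥ c`, `c > 0`; it stands in for the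
spectral projections of `C`. -/
theorem exists_sq_partition_of_unity {C : H →L[ℂ] H} {c q : ℝ} (hc : 0 < c) (hq : 1 < q)
    (hC : c • 1 ≤ C) :
    ∃ (N : ℕ) (S : ℕ → (H →L[ℂ] H)) (μ : ℕ → ℝ), (∀ i, IsSelfAdjoint (S i)) ∧
      (∀ i, ‖S i‖ ≤ 1) ∧ (∀ i, Commute (S i) C) ∧ (∀ i, 0 ≤ μ i) ∧
      ∑ i ∈ Finset.range N, S i * S i = 1 ∧
      ∀ i, μ i • (S i * S i) ≤ S i * C * S i ∧ S i * C * S i ≤ (q * μ i) • (S i * S i) := by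
  have hCsa : IsSelfAdjoint C :=
    IsSelfAdjoint.of_nonneg ((smul_nonneg hc.le zero_le_one).trans hC)
  have hspec : ∀ x ∈ spectrum ℝ C, c ≤ x :=
    (algebraMap_le_iff_le_spectrum hCsa).1 (by rwa [Algebra.algebraMap_eq_smul_one])
  have hspec' : ∀ x ∈ spectrum ℝ C, x ≤ ‖C‖ :=
    (le_algebraMap_iff_spectrum_le hCsa).1 hCsa.le_algebraMap_norm_self
  obtain ⟨N, g, μ, hgc, hg0, hg1, hμ, hsum, hg⟩ := exists_partition_of_unity_Icc hc hq ‖C‖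
  have hgs : ∀ i, Continuous fun x => √(g i x) := fun i => (hgc i).sqrt
  have hSS : ∀ i, cfc (fun x => √(g i x)) C * cfc (fun x => √(g i x)) C = cfc (g i) C := by
    intro i
    rw [← cfc_mul _ _ C (hgs i).continuousOn (hgs i).continuousOn]
    exact cfc_congr fun x _ => Real.mul_self_sqrt (hg0 i x)
  have hcomm : ∀ i, Commute (cfc (fun x => √(g i x)) C) C :=
    fun i => (Commute.refl C).cfc_real _
  have hSCS : ∀ i, cfc (fun x => √(g i x)) C * C * cfc (fun x => √(g i x)) C
      = cfc (fun x => x * g i x) C := by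
    intro i
    rw [(hcomm i).eq, mul_assoc, hSS,
      cfc_mul (fun x => x) _ C continuous_id.continuousOn (hgc i).continuousOn, cfc_id' ℝ C]
  refine ⟨N, fun i => cfc (fun x => √(g i x)) C, μ, fun i => cfc_predicate _ C, fun i => ?_,
    hcomm, hμ, ?_, fun i => ?_⟩
  · refine norm_cfc_le zero_le_one fun x _ => ?_
    rw [Real.norm_of_nonneg (Real.sqrt_nonneg _)]
    exact Real.sqrt_le_one.2 (hg1 i x)
  · simp only [hSS]
    rw [← cfc_sum _ C _ (fun i _ => (hgc i).continuousOn), ← cfc_one ℝ C]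
    exact cfc_congr fun x hx => by simpa using hsum x (hspec x hx) (hspec' x hx)
  · rw [hSS, hSCS, ← cfc_smul _ _ C (hgc i).continuousOn, ← cfc_smul _ _ C (hgc i).continuousOn]
    have hc1 : Continuous fun x => x * g i x := continuous_id.mul (hgc i)
    have hc2 : ∀ r : ℝ, Continuous fun x => r • g i x := fun r => (hgc i).const_smul r
    exact ⟨cfc_mono (fun x _ => (hg i x).1) (hc2 _).continuousOn hc1.continuousOn,
      cfc_mono (fun x _ => (hg i x).2) hc1.continuousOn (hc2 _).continuousOn⟩

/-! ### Positive linear maps -/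

/-- Positive operators `P i` with sum `1` such that `∑ μ i • P i ≤ C`, while `1 σ C` is at most `q`
times the sum of the values of `σ` at the proportional pairs `(P i, μ i • P i)`.  These values are
`f i • P i`, where the scalar `f i` does not depend on the space; what is recorded about it is that
it bounds `1 σ (μ i • 1)` on `K` from below. -/
theorem OperatorConnection.exists_proportional_decomposition_one [Nontrivial H]
    (σ : OperatorConnection.{u}) (K : Type u) [NormedAddCommGroup K] [InnerProductSpace ℂ K]
    [CompleteSpace K] {C : H →L[ℂ] H} {c q : ℝ} (hc : 0 < c) (hq : 1 < q) (hC : c • 1 ≤ C) :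
    ∃ (N : ℕ) (P : ℕ → (H →L[ℂ] H)) (μ f : ℕ → ℝ), (∀ i, 0 ≤ P i) ∧ (∀ i, 0 ≤ μ i) ∧
      (∀ i, f i • 1 ≤ σ.op (1 : K →L[ℂ] K) (μ i • 1)) ∧ ∑ i ∈ Finset.range N, P i = 1 ∧
      ∑ i ∈ Finset.range N, μ i • P i ≤ C ∧
      σ.op 1 C ≤ ∑ i ∈ Finset.range N, (q * f i) • P i := by
  have hC0 : 0 ≤ C := (smul_nonneg hc.le zero_le_one).trans hC
  obtain ⟨N, T, μ, hT, hT1, hTC, hμ, hsum, hTb⟩ := exists_sq_partition_of_unity hc hq hC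
  choose f hfH hfK using fun i => σ.exists_scalar_one_op H K (hμ i)
  have hTT : ∀ i, 0 ≤ T i * T i := fun i => (hT i).mul_self_nonneg
  -- an operator commuting with the partition of unity is the sum of its localizations
  have hloc : ∀ X : H →L[ℂ] H, (∀ i, Commute (T i) X) →
      X = ∑ i ∈ Finset.range N, T i * X * T i := fun X hX => by
    have : ∀ i, T i * X * T i = X * (T i * T i) := fun i => by rw [(hX i).eq, mul_assoc]
    simp only [this]
    rw [← Finset.mul_sum, hsum, mul_one]
  refine ⟨N, fun i => T i * T i, μ, f, hTT, hμ, hfK, hsum, ?_, ?_⟩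
  · rw [hloc C hTC]
    exact Finset.sum_le_sum fun i _ => (hTb i).1
  · rw [hloc (σ.op 1 C) fun i => σ.commute_one_op hC0 (hT i) (hT1 i) (hTC i)]
    refine Finset.sum_le_sum fun i _ => ?_
    -- the first entry is enlarged by `q` as well, so that the ratio stays `μ i` and the scalar `f i`
    -- is the one that also serves on `K`
    have hqT : T i * T i ≤ q • (T i * T i) := by
      simpa using smul_le_smul_of_nonneg_right hq.le (hTT i)
    calc T i * σ.op 1 C * T i ≤ σ.op (T i * T i) (T i * C * T i) := by
          simpa using σ.conj_op_le (hT i) zero_le_one hC0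
      _ ≤ σ.op (q • (T i * T i)) (μ i • q • (T i * T i)) := by
          refine σ.op_mono _ _ _ _ (hTT i) ((hT i).conjugate_nonneg hC0) hqT ?_
          rw [smul_smul, mul_comm (μ i)]
          exact (hTb i).2
      _ ≤ f i • q • (T i * T i) :=
          σ.op_smul_le_smul (hμ i) (hfH i) (smul_nonneg (by linarith) (hTT i))
      _ = (q * f i) • (T i * T i) := by rw [smul_smul, mul_comm]

/-- `exists_proportional_decomposition_one` transported by a congruence to a pair `(A, B)`. -/
theorem OperatorConnection.exists_proportional_decomposition [Nontrivial H]
    (σ : OperatorConnection.{u}) (K : Type u) [NormedAddCommGroup K] [InnerProductSpace ℂ K]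
    [CompleteSpace K] {A B : H →L[ℂ] H} {ε q : ℝ} (hε : 0 < ε) (hq : 1 < q)
    (hA : ε • 1 ≤ A) (hB : ε • 1 ≤ B) :
    ∃ (N : ℕ) (P : ℕ → (H →L[ℂ] H)) (μ f : ℕ → ℝ), (∀ i, 0 ≤ P i) ∧ (∀ i, 0 ≤ μ i) ∧
      (∀ i, f i • 1 ≤ σ.op (1 : K →L[ℂ] K) (μ i • 1)) ∧ ∑ i ∈ Finset.range N, P i = A ∧
      ∑ i ∈ Finset.range N, μ i • P i ≤ B ∧
      σ.op A B ≤ ∑ i ∈ Finset.range N, (q * f i) • P i := by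
  have hA0 : 0 ≤ A := (smul_nonneg hε.le zero_le_one).trans hA
  have hB0 : 0 ≤ B := (smul_nonneg hε.le zero_le_one).trans hB
  obtain ⟨S, R, hS, hR, hSS, hSR, hRS⟩ := exists_sqrt_with_inverse hε hA
  obtain ⟨c, hc, hC⟩ := exists_smul_one_le_conj hε hA0 hB hR hSS hSR hRS
  have hSCS : S * (R * B * R) * S = B := by
    calc S * (R * B * R) * S = (S * R) * B * (R * S) := by noncomm_ring
      _ = B := by rw [hRS, hSR, one_mul, mul_one]
  have hAB := σ.op_conj_le hS hR hSR hRS zero_le_one (hR.conjugate_nonneg hB0)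
  rw [mul_one, hSS, hSCS] at hAB
  obtain ⟨N, P, μ, f, hP, hμ, hf, hsum, hsumμ, hop⟩ :=
    σ.exists_proportional_decomposition_one K hc hq hC
  have hconj : ∀ r : ℕ → ℝ, ∑ i ∈ Finset.range N, r i • (S * P i * S)
      = S * (∑ i ∈ Finset.range N, r i • P i) * S := fun r => by
    simp only [Finset.mul_sum, Finset.sum_mul, mul_smul_comm, smul_mul_assoc]
  refine ⟨N, fun i => S * P i * S, μ, f, fun i => hS.conjugate_nonneg (hP i), hμ, hf, ?_, ?_, ?_⟩
  · rw [← Finset.sum_mul, ← Finset.mul_sum, hsum, mul_one, hSS]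
  · rw [hconj]
    exact (hS.conjugate_le_conjugate hsumμ).trans hSCS.le
  · rw [hconj]
    exact hAB.trans (hS.conjugate_le_conjugate hop)

theorem OperatorConnection.map_op_le_of_bounded_below [Nontrivial H] (σ : OperatorConnection.{u})
    {Φ : (H →L[ℂ] H) →ₗ[ℂ] (K →L[ℂ] K)} (hΦ : ∀ X, 0 ≤ X → 0 ≤ Φ X) {A B : H →L[ℂ] H} {ε : ℝ}
    (hε : 0 < ε) (hA : ε • 1 ≤ A) (hB : ε • 1 ≤ B) :
    Φ (σ.op A B) ≤ σ.op (Φ A) (Φ B) := by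
  -- the decomposition is used with the factor `q = 1 + η`, and `η` tends to `0`
  refine le_of_forall_pos_le_add_smul (Z := σ.op (Φ A) (Φ B)) fun η hη => ?_
  obtain ⟨N, P, μ, f, hP, hμ, hf, hsum, hsumμ, hop⟩ :=
    σ.exists_proportional_decomposition K hε (lt_add_of_pos_right 1 hη) hA hB
  have hQ : ∀ i, 0 ≤ Φ (P i) := fun i => hΦ _ (hP i)
  have hsum' : ∀ r : ℕ → ℝ, Φ (∑ i ∈ Finset.range N, r i • P i)
      = ∑ i ∈ Finset.range N, r i • Φ (P i) := fun r => by
    simp only [map_sum, LinearMap.map_smul_of_tower]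
  have hΦA : ∑ i ∈ Finset.range N, Φ (P i) = Φ A := by rw [← map_sum, hsum]
  have hΦB : ∑ i ∈ Finset.range N, μ i • Φ (P i) ≤ Φ B := by
    rw [← hsum']
    exact map_le_map_of_positive hΦ hsumμ
  calc Φ (σ.op A B)
      ≤ ∑ i ∈ Finset.range N, ((1 + η) * f i) • Φ (P i) := by
        rw [← hsum']
        exact map_le_map_of_positive hΦ hop
    _ = (1 + η) • ∑ i ∈ Finset.range N, f i • Φ (P i) := by
        simp only [Finset.smul_sum, mul_smul]
    _ ≤ (1 + η) • σ.op (Φ A) (Φ B) := by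
        refine smul_le_smul_of_nonneg_left ?_ (by linarith)
        calc ∑ i ∈ Finset.range N, f i • Φ (P i)
            ≤ ∑ i ∈ Finset.range N, σ.op (Φ (P i)) (μ i • Φ (P i)) :=
              Finset.sum_le_sum fun i _ => σ.smul_le_op_smul (hμ i) (hf i) (hQ i)
          _ ≤ σ.op (∑ i ∈ Finset.range N, Φ (P i)) (∑ i ∈ Finset.range N, μ i • Φ (P i)) :=
              σ.sum_op_le _ _ _ (fun i _ => hQ i) fun i _ => smul_nonneg (hμ i) (hQ i)
          _ ≤ σ.op (Φ A) (Φ B) :=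
              σ.op_mono _ _ _ _ (Finset.sum_nonneg fun i _ => hQ i)
                (Finset.sum_nonneg fun i _ => smul_nonneg (hμ i) (hQ i)) hΦA.le hΦB
    _ = σ.op (Φ A) (Φ B) + η • σ.op (Φ A) (Φ B) := by rw [add_smul, one_smul]

/-- A positive linear map, unital or not, satisfies `Φ (A σ B) ≤ Φ A σ Φ B`. -/
theorem OperatorConnection.map_op_le (σ : OperatorConnection.{u})
    {Φ : (H →L[ℂ] H) →ₗ[ℂ] (K →L[ℂ] K)} (hΦ : ∀ X, 0 ≤ X → 0 ≤ Φ X) {A B : H →L[ℂ] H}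
    (hA : 0 ≤ A) (hB : 0 ≤ B) : Φ (σ.op A B) ≤ σ.op (Φ A) (Φ B) := by
  rcases subsingleton_or_nontrivial H with hH | hH
  · rw [Subsingleton.elim (σ.op A B) 0, map_zero]
    exact σ.op_nonneg _ _ (hΦ A hA) (hΦ B hB)
  have hΦ1 : 0 ≤ Φ 1 := hΦ 1 zero_le_one
  have hpos : ∀ m : ℕ, 0 < 1 / ((m : ℝ) + 1) := fun m => Nat.one_div_pos_of_nat
  have hpert : ∀ m : ℕ, Φ (σ.op A B) ≤
      σ.op (Φ A + (1 / ((m : ℝ) + 1)) • Φ 1) (Φ B + (1 / ((m : ℝ) + 1)) • Φ 1) := by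
    intro m
    have hm : 0 ≤ (1 / ((m : ℝ) + 1)) • (1 : H →L[ℂ] H) := smul_nonneg (hpos m).le zero_le_one
    have h := (map_le_map_of_positive hΦ (σ.op_mono A B _ _ hA hB
      (le_add_of_nonneg_right hm) (le_add_of_nonneg_right hm))).trans
      (σ.map_op_le_of_bounded_below hΦ (hpos m) (le_add_of_nonneg_left hA)
        (le_add_of_nonneg_left hB))
    rwa [map_add, map_add, LinearMap.map_smul_of_tower] at h
  have hlim := σ.continuous_above _ _ _ _
    (fun m => add_nonneg (hΦ A hA) (smul_nonneg (hpos m).le hΦ1))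
    (fun m => add_nonneg (hΦ B hB) (smul_nonneg (hpos m).le hΦ1))
    (decreasesStronglyTo_add_one_div_smul (Φ A) hΦ1) (decreasesStronglyTo_add_one_div_smul (Φ B) hΦ1)
  refine ContinuousLinearMap.le_of_forall_re_inner_le
    (IsSelfAdjoint.of_nonneg (hΦ _ (σ.op_nonneg A B hA hB)))
    (IsSelfAdjoint.of_nonneg (σ.op_nonneg _ _ (hΦ A hA) (hΦ B hB))) fun x _ => ?_
  exact ge_of_tendsto'
    ((Complex.continuous_re.tendsto _).comp ((hlim.2 x).inner tendsto_const_nhds))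
    fun m => ContinuousLinearMap.re_inner_le_of_le (hpert m) x

theorem OperatorConnection.sum_smul_map_op_le (σ : OperatorConnection.{u}) {ι : Type*}
    {Φ : ι → ((H →L[ℂ] H) →ₗ[ℂ] (K →L[ℂ] K))} (hΦ : ∀ i X, 0 ≤ X → 0 ≤ Φ i X)
    {A B : ι → (H →L[ℂ] H)} (hA : ∀ i, 0 ≤ A i) (hB : ∀ i, 0 ≤ B i) {w : ι → ℝ}
    (hw : ∀ i, 0 ≤ w i) (s : Finset ι) :
    ∑ i ∈ s, w i • Φ i (σ.op (A i) (B i)) ≤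
      σ.op (∑ i ∈ s, w i • Φ i (A i)) (∑ i ∈ s, w i • Φ i (B i)) := by
  refine (Finset.sum_le_sum fun i _ => ?_).trans (σ.sum_op_le s _ _
    (fun i _ => smul_nonneg (hw i) (hΦ i _ (hA i)))
    fun i _ => smul_nonneg (hw i) (hΦ i _ (hB i)))
  -- apply `map_op_le` to the positive, not unital, map `w i • Φ i`
  exact σ.map_op_le (Φ := w i • Φ i) (fun X hX => smul_nonneg (hw i) (hΦ i X hX)) (hA i) (hB i)

end

theorem mainTheorem3
    {H K : Type u} [NormedAddCommGroup H] [InnerProductSpace ℂ H] [CompleteSpace H]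
    [NormedAddCommGroup K] [InnerProductSpace ℂ K] [CompleteSpace K]
    (σ : OperatorConnection.{u}) (n : ℕ)
    (Φ : Fin n → ((H →L[ℂ] H) →ₗ[ℂ] (K →L[ℂ] K)))
    (hΦ_pos : ∀ i (X : H →L[ℂ] H), 0 ≤ X → 0 ≤ Φ i X)
    (hΦ_one : ∀ i, Φ i 1 = 1)
    (A B : Fin n → (H →L[ℂ] H))
    (hA : ∀ i, IsStrictlyPositiveOp (A i)) (hB : ∀ i, IsStrictlyPositiveOp (B i))
    (w : Fin n → ℝ) (hw_pos : ∀ i, 0 < w i) (hw_sum : ∑ i, w i = 1)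
    (J : Finset (Fin n)) (hJ : J ⊂ Finset.univ) :
    (∑ i, w i • Φ i (σ.op (A i) (B i))
      ≤ σ.op (∑ i ∈ J, w i • Φ i (A i)) (∑ i ∈ J, w i • Φ i (B i))
        + σ.op (∑ i ∈ Jᶜ, w i • Φ i (A i)) (∑ i ∈ Jᶜ, w i • Φ i (B i))) ∧
    (σ.op (∑ i ∈ J, w i • Φ i (A i)) (∑ i ∈ J, w i • Φ i (B i))
        + σ.op (∑ i ∈ Jᶜ, w i • Φ i (A i)) (∑ i ∈ Jᶜ, w i • Φ i (B i))
      ≤ σ.op (∑ i, w i • Φ i (A i)) (∑ i, w i • Φ i (B i))) := by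
  have hA0 := fun i => (hA i).nonneg
  have hB0 := fun i => (hB i).nonneg
  have hw0 := fun i => (hw_pos i).le
  have hs : ∀ {X : Fin n → (H →L[ℂ] H)}, (∀ i, 0 ≤ X i) → ∀ s : Finset (Fin n),
      0 ≤ ∑ i ∈ s, w i • Φ i (X i) := fun hX s =>
    Finset.sum_nonneg fun i _ => smul_nonneg (hw0 i) (hΦ_pos i _ (hX i))
  constructor
  · rw [← Finset.sum_add_sum_compl J]
    exact add_le_add (σ.sum_smul_map_op_le hΦ_pos hA0 hB0 hw0 J)
      (σ.sum_smul_map_op_le hΦ_pos hA0 hB0 hw0 Jᶜ)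
  · rw [← Finset.sum_add_sum_compl J (fun i => w i • Φ i (A i)),
      ← Finset.sum_add_sum_compl J (fun i => w i • Φ i (B i))]
    exact σ.op_add_op_le (hs hA0 J) (hs hB0 J) (hs hA0 Jᶜ) (hs hB0 Jᶜ)
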